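/- For natural numbers $k<n$ let $S^n_k=\{\alpha<\omega_n : \operatorname{cf}\alpha=\omega_k\}$. For a set $S$ of ordinals and a limit ordinal $\gamma$ of uncountable cofinality, say that $S$ reflects at $\gamma$ if $S\cap\gamma$ is a stationary subset of $\gamma$. For stationary sets $S,A\subseteq\omega_n$ (with $n\ge 1$), say that $S$ reflects fully in $A$ if the set of all $\alpha\in A$ at which $S$ does not reflect is nonstationary in $\omega_n$. Proposition (ZFC). Let $m\ge 2$ be a natural number. Then at least one of the following holds: (a) for every natural number $k<m-1$ there exists a stationary (in $\omega_m$) set $S\subseteq S^m_k$ that does not reflect fully in $S^m_{m-1}$; (b) for every natural number $n>m$ there exists a stationary (in $\omega_n$) set $A\subseteq S^n_{m-1}$ that does not reflect at any $\delta\in S^n_m$. -/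

import Mathlib

universe u

namespace FullReflection

/-- `S ∩ γ` is a stationary subset of the ordinal `γ`, where `γ` is identified with the
well-order `Set.Iio γ` of its elements: `S` meets every closed unbounded subset of `γ`. -/
def StationaryIn (γ : Ordinal.{u}) (S : Set Ordinal.{u}) : Prop :=
  IsStationary ((Subtype.val : Set.Iio γ → Ordinal.{u}) ⁻¹' S)

/-- `S` reflects at `γ`: the set `S ∩ γ` is stationary in `γ`. -/
def ReflectsAt (S : Set Ordinal.{u}) (γ : Ordinal.{u}) : Prop :=
  StationaryIn γ S

/-- For `S, A ⊆ κ`: `S` reflects fully in `A` (as subsets of `κ`), i.e. `S` reflects at all `α ∈ A`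
with the exception of a set of `α`'s that is nonstationary in `κ`. -/
def ReflectsFully (κ : Ordinal.{u}) (S A : Set Ordinal.{u}) : Prop :=
  ¬ StationaryIn κ {α | α ∈ A ∧ ¬ ReflectsAt S α}

/-- `S^n_k`, the set of all `α < ω_n` of cofinality `ω_k`. -/
def cofSet (n k : ℕ) : Set Ordinal.{u} :=
  {α | α < Ordinal.omega (n : Ordinal.{u}) ∧ α.cof = Cardinal.aleph (k : Ordinal.{u})}

end FullReflection

/-!
Suppose the first alternative fails: for some `k < m - 1`, every stationary subset of `S^m_k`
reflects at almost all points of `S^m_{m-1}`. Attach to every limit ordinal `α` a club `c α` of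
size at most `cf α`, and let `X α` be the union of the `c β` over those `β ∈ c α` with
`cf β = ω_k` (`ladderPoints`). For `α ∈ S^n_{m-1}` the set `X α` has size less than `ℵ_m`, hence
order type less than `ω_m`. Since `m < n`, there is a single `ρ < ω_m` for which the set `A` of all
`α ∈ S^n_{m-1}` such that `X α` has order type `ρ` is stationary in `ω_n`. This `A` does not reflect
at any `δ ∈ S^n_m`.

To see this, identify `ω_m` with a club of `δ` through a normal function `f` with `f ω_m = δ`; then
stationarity in `f j` and in `j` amount to the same (`stationaryIn_map_iff`). A pressing-down
argument (`exists_stationaryIn_inter_Ico`) yields, for every `γ < ω_m`, some `γ' < ω_m` such that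
`c (f i)` meets `[f γ, f γ')` for stationarily many `i ∈ S^m_k`. Iterating it produces a
strictly increasing sequence of `γ_i`, `i < ω_m`, such that each interval `[f γ_i, f γ_{i+1})` is
met in this sense stationarily often. The `ρ + 1` stationary sets belonging to `i ≤ ρ` reflect
simultaneously at all `j ∈ S^m_{m-1}` in a club. If `A` reflected at `δ`, there would be such a `j`
with `f j ∈ A`. Each of the `ρ + 1` sets being stationary in `j`, its image under `f` meets
`c (f j)`, so `X (f j)` meets each of the `ρ + 1` intervals, which are pairwise disjoint. Hence its
order type is at least `ρ + 1`, whereas membership in `A` makes it equal to `ρ`.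
-/

universe v

namespace FullReflection

open Cardinal Order Set Ordinal

/-! ### Clubs and stationary sets of ordinals -/

/-- `C ∩ γ` is closed and unbounded in `γ`. Elements of `C` beyond `γ` are allowed, and closure
is required only at the nonzero limits `x < γ` of points of `C`. -/
def IsClubIn (γ : Ordinal.{u}) (C : Set Ordinal.{u}) : Prop :=
  (∀ a < γ, ∃ b ∈ C, a ≤ b ∧ b < γ) ∧
    ∀ x < γ, x ≠ 0 → (∀ a < x, ∃ b ∈ C, a < b ∧ b < x) → x ∈ C

theorem isClub_preimage_iff {γ : Ordinal.{u}} {C : Set Ordinal.{u}} :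
    IsClub ((Subtype.val : Iio γ → Ordinal.{u}) ⁻¹' C) ↔ IsClubIn γ C := by
  constructor
  · intro h
    refine ⟨fun a ha ↦ ?_, fun x hx hx0 hlim ↦ ?_⟩
    · obtain ⟨b, hb, hab⟩ := h.isCofinal ⟨a, ha⟩
      exact ⟨b, hb, hab, b.2⟩
    · refine h.isLUB_mem (t := {b : Iio γ | b.1 ∈ C ∧ b.1 < x}) (x := ⟨x, hx⟩)
        (fun b hb ↦ hb.1) ?_ ⟨fun b hb ↦ hb.2.le, fun c hc ↦ ?_⟩
      · obtain ⟨b, hb, -, hbx⟩ := hlim 0 (pos_iff_ne_zero.2 hx0)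
        exact ⟨⟨b, hbx.trans hx⟩, hb, hbx⟩
      · by_contra! hcx
        obtain ⟨b, hb, hcb, hbx⟩ := hlim c hcx
        exact (hc (a := ⟨b, hbx.trans hx⟩) ⟨hb, hbx⟩).not_gt hcb
  · rintro ⟨h1, h2⟩
    refine ⟨fun d hd hd0 _ a ha ↦ ?_, fun a ↦ ?_⟩
    · by_cases had : a ∈ d
      · exact hd had
      have hlt : ∀ b ∈ d, b < a := fun b hb ↦
        lt_of_le_of_ne (ha.1 hb) (fun h ↦ had (h ▸ hb))
      refine h2 a a.2 ?_ fun c hc ↦ ?_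
      · obtain ⟨b, hb⟩ := hd0
        exact ((zero_le (a := b.1)).trans_lt (hlt b hb : b.1 < a.1)).ne'
      · obtain ⟨b, hb, hcb⟩ := (lt_isLUB_iff ha (b := ⟨c, hc.trans a.2⟩)).1 hc
        exact ⟨b, hd hb, hcb, hlt b hb⟩
    · obtain ⟨b, hb, hab, hbγ⟩ := h1 a a.2
      exact ⟨⟨b, hbγ⟩, hb, hab⟩

theorem stationaryIn_iff {γ : Ordinal.{u}} {S : Set Ordinal.{u}} :
    StationaryIn γ S ↔ ∀ C, IsClubIn γ C → ∃ x ∈ S, x ∈ C ∧ x < γ := by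
  constructor
  · intro h C hC
    obtain ⟨x, hxS, hxC⟩ := h (isClub_preimage_iff.2 hC)
    exact ⟨x, hxS, hxC, x.2⟩
  · intro h t ht
    obtain ⟨x, hxS, hxC, hx⟩ := h (Subtype.val '' t)
      (isClub_preimage_iff.1 (by rwa [preimage_image_eq _ Subtype.val_injective]))
    obtain ⟨y, hy, rfl⟩ := hxC
    exact ⟨y, hxS, hy⟩

theorem not_stationaryIn_iff {γ : Ordinal.{u}} {S : Set Ordinal.{u}} :
    ¬ StationaryIn γ S ↔ ∃ C, IsClubIn γ C ∧ ∀ x ∈ S, x ∈ C → γ ≤ x := by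
  rw [stationaryIn_iff]
  push Not
  rfl

theorem cof_Iio_eq_lift (γ : Ordinal.{u}) :
    Order.cof (Iio γ) = Cardinal.lift.{u + 1} γ.cof := by
  rw [Ordinal.cof_Iio, Ordinal.lift_cof]

theorem IsClubIn.iInter {γ : Ordinal.{u}} (hγ : ℵ₀ < γ.cof) {ι : Type v}
    (hι : Cardinal.lift.{u + 1} #ι < Cardinal.lift.{max v (u + 1)} γ.cof)
    {C : ι → Set Ordinal.{u}} (hC : ∀ i, IsClubIn γ (C i)) : IsClubIn γ (⋂ i, C i) := by
  rw [← isClub_preimage_iff, preimage_iInter]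
  refine IsClub.iInter ?_ ?_ fun i ↦ isClub_preimage_iff.2 (hC i)
  · rw [cof_Iio_eq_lift]
    exact (aleph0_lt_lift.2 hγ).ne'
  · rw [cof_Iio_eq_lift, Cardinal.lift_lift]
    exact hι

theorem IsClubIn.inter {γ : Ordinal.{u}} (hγ : ℵ₀ < γ.cof) {C D : Set Ordinal.{u}}
    (hC : IsClubIn γ C) (hD : IsClubIn γ D) : IsClubIn γ (C ∩ D) := by
  rw [← isClub_preimage_iff] at hC hD ⊢
  refine hC.inter ?_ hD
  rw [cof_Iio_eq_lift]
  exact (aleph0_lt_lift.2 hγ).ne'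

/-! ### Normal functions -/

theorem isSuccLimit_of_forall_lt {x : Ordinal.{u}} (hx : x ≠ 0)
    (h : ∀ a < x, ∃ b, a < b ∧ b < x) : IsSuccLimit x := by
  refine isSuccLimit_iff.2 ⟨hx, isSuccPrelimit_of_succ_lt fun a ha ↦ ?_⟩
  obtain ⟨b, hab, hb⟩ := h a ha
  exact (succ_le_of_lt hab).trans_lt hb

theorem isClubIn_isSuccLimit {γ : Ordinal.{u}} (hγ : ℵ₀ < γ.cof) :
    IsClubIn γ {x | IsSuccLimit x} := by
  refine ⟨fun a ha ↦ ⟨a + ω, isSuccLimit_add a isSuccLimit_omega0, le_self_add, ?_⟩,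
    fun x _ hx0 h ↦ isSuccLimit_of_forall_lt hx0 fun a ha ↦ ?_⟩
  · have hlim : IsSuccLimit γ := Ordinal.one_lt_cof_iff.1 (one_lt_aleph0.trans hγ)
    refine lt_of_le_of_ne ((isNormal_add_right a).le_iff_forall_le isSuccLimit_omega0 |>.2
      fun b hb ↦ ?_) fun h ↦ ?_
    · obtain ⟨n, rfl⟩ := lt_omega0.1 hb
      exact (hlim.add_natCast_lt ha n).le
    · rw [← h, cof_add _ omega0_ne_zero, cof_omega0] at hγ
      exact hγ.false
  · obtain ⟨b, -, hb⟩ := h a ha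
    exact ⟨b, hb⟩

/-- Transfinite iteration of `G`: a normal function `f` with `f (j + 1)` beyond `G j (f j)`. As long
as `G` does not leave `δ`, the first `cf δ` values of `f` stay below `δ`. -/
theorem exists_isNormal (G : Ordinal.{u} → Ordinal.{u} → Ordinal.{u}) :
    ∃ f : Ordinal.{u} → Ordinal.{u}, IsNormal f ∧ (∀ j, G j (f j) < f (j + 1)) ∧
      ∀ δ : Ordinal.{u}, IsSuccLimit δ → (∀ j < δ.cof.ord, ∀ x < δ, G j x < δ) →
        ∀ j < δ.cof.ord, f j < δ := by
  let f : Ordinal.{u} → Ordinal.{u} := fun o ↦ limitRecOn o 0 (fun j x ↦ max x (G j x) + 1)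
    fun a _ IH ↦ ⨆ i : Iio a, IH i.1 i.2
  have f_zero : f 0 = 0 := limitRecOn_zero ..
  have f_succ : ∀ j, f (j + 1) = max (f j) (G j (f j)) + 1 := fun j ↦ limitRecOn_add_one ..
  have f_limit : ∀ a, IsSuccLimit a → f a = ⨆ i : Iio a, f i := fun a ha ↦
    limitRecOn_limit _ _ _ _ ha
  refine ⟨f, ?_, fun j ↦ ?_, fun δ hδ hG j ↦ ?_⟩
  · refine IsNormal.of_succ_lt (fun a ↦ ?_) fun {a} ha ↦ ?_
    · rw [Order.succ_eq_add_one, f_succ, Order.lt_add_one_iff]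
      exact le_max_left _ _
    · rw [f_limit a ha, image_eq_range]
      have : Nonempty (Iio a) := ⟨⟨0, ha.bot_lt⟩⟩
      exact isLUB_ciSup bddAbove_of_small
  · rw [f_succ, Order.lt_add_one_iff]
    exact le_max_right _ _
  · induction j using limitRecOn with
    | zero => intro _; rw [f_zero]; exact hδ.bot_lt
    | add_one j IH =>
      intro hj
      have hj' := (lt_add_one j).trans hj
      rw [f_succ]
      exact hδ.succ_lt (max_lt (IH hj') (hG j hj' _ (IH hj')))
    | limit a ha IH =>
      intro hj
      rw [f_limit a ha]
      refine lift_iSup_lt_of_lt_cof ?_ fun i ↦ IH i.1 i.2 (i.2.trans hj)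
      rw [← Ordinal.lift_cof, Cardinal.mk_Iio_ordinal, Cardinal.lift_lift, Cardinal.lift_lt]
      exact lt_ord.1 hj

theorem isSuccLimit_ord_cof {δ : Ordinal.{u}} (hδ : IsSuccLimit δ) : IsSuccLimit δ.cof.ord :=
  isSuccLimit_ord (aleph0_le_cof_iff.2 (Ordinal.one_lt_cof_iff.2 hδ))

theorem exists_isNormal_map_cof {δ : Ordinal.{u}} (hδ : IsSuccLimit δ) :
    ∃ f : Ordinal.{u} → Ordinal.{u}, IsNormal f ∧ f δ.cof.ord = δ := by
  obtain ⟨s, hs, hs'⟩ := Order.exists_cof_eq (Iio δ)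
  obtain ⟨e⟩ : Nonempty (Iio δ.cof.ord ≃ s) := by
    rw [← Cardinal.eq, hs', cof_Iio_eq_lift, Cardinal.mk_Iio_ordinal, card_ord]
  classical
  obtain ⟨f, hf, hf1, hf2⟩ := exists_isNormal fun j _ ↦
    if h : j < δ.cof.ord then (e ⟨j, h⟩).1.1 else 0
  have hcof := isSuccLimit_ord_cof hδ
  refine ⟨f, hf, le_antisymm ?_ ?_⟩
  · refine (hf.le_iff_forall_le hcof).2 fun j hj ↦ (hf2 δ hδ (fun i hi x hx ↦ ?_) j hj).le
    rw [dif_pos hi]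
    exact (e ⟨i, hi⟩).1.2
  · refine le_of_forall_lt fun a ha ↦ ?_
    obtain ⟨b, hb, hab⟩ := hs ⟨a, ha⟩
    obtain ⟨⟨j, hj⟩, hje⟩ := e.surjective ⟨b, hb⟩
    have h := hf1 j
    rw [dif_pos (show j < δ.cof.ord from hj), hje] at h
    have hab' : a ≤ b.1 := hab
    exact hab'.trans_lt (h.trans (hf.strictMono (hcof.succ_lt hj)))

theorem IsClubIn.image {f : Ordinal.{u} → Ordinal.{u}} (hf : IsNormal f) {j : Ordinal.{u}}
    (hj : IsSuccLimit j) {E : Set Ordinal.{u}} (hE : IsClubIn j E) :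
    IsClubIn (f j) (f '' E) := by
  refine ⟨fun a ha ↦ ?_, fun x hx hx0 hlim ↦ ?_⟩
  · obtain ⟨i, hi, hai⟩ := (hf.lt_iff_exists_lt hj).1 ha
    obtain ⟨b, hb, hib, hbj⟩ := hE.1 i hi
    exact ⟨f b, mem_image_of_mem f hb, hai.le.trans (hf.monotone hib), hf.strictMono hbj⟩
  · -- The least `y` with `x ≤ f y` is a limit point of `E`, so that continuity gives `f y = x`.
    obtain ⟨y, hxy, hmin⟩ := exists_minimal_of_wellFoundedLT (fun y ↦ x ≤ f y) ⟨j, hx.le⟩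
    replace hmin : ∀ a < y, f a < x := fun a ha ↦ by
      by_contra! h
      exact (hmin h ha.le).not_gt ha
    have hyj : y < j := by
      by_contra! h
      obtain ⟨i, hi, hxi⟩ := (hf.lt_iff_exists_lt hj).1 hx
      exact (hmin i (hi.trans_le h)).not_gt hxi
    have hlim' : ∀ a < y, ∃ b ∈ E, a < b ∧ b < y := fun a ha ↦ by
      obtain ⟨_, ⟨b, hb, rfl⟩, hab, hbx⟩ := hlim (f a) (hmin a ha)
      exact ⟨b, hb, hf.strictMono.lt_iff_lt.1 hab, hf.strictMono.lt_iff_lt.1 (hbx.trans_le hxy)⟩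
    have hy0 : y ≠ 0 := by
      obtain ⟨_, ⟨b, hb, rfl⟩, -, hbx⟩ := hlim 0 (pos_iff_ne_zero.2 hx0)
      exact (bot_le.trans_lt (hf.strictMono.lt_iff_lt.1 (hbx.trans_le hxy))).ne'
    have hy : IsSuccLimit y := isSuccLimit_of_forall_lt hy0 fun a ha ↦
      let ⟨b, _, hb⟩ := hlim' a ha
      ⟨b, hb⟩
    exact ⟨y, hE.2 y hyj hy0 hlim',
      le_antisymm ((hf.le_iff_forall_le hy).2 fun a ha ↦ (hmin a ha).le) hxy⟩

theorem isClubIn_univ {j : Ordinal.{u}} : IsClubIn j univ :=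
  ⟨fun a ha ↦ ⟨a, mem_univ a, le_rfl, ha⟩, fun _ _ _ _ ↦ mem_univ _⟩

theorem isSuccLimit_of_aleph0_lt_cof {j : Ordinal.{u}} (hj : ℵ₀ < j.cof) : IsSuccLimit j :=
  Ordinal.one_lt_cof_iff.1 (one_lt_aleph0.trans hj)

/-- Uncountable cofinality makes `C` meet the range of `f`, which is itself a club of `f j`. -/
theorem IsClubIn.preimage {f : Ordinal.{u} → Ordinal.{u}} (hf : IsNormal f) {j : Ordinal.{u}}
    (hj : ℵ₀ < j.cof) {C : Set Ordinal.{u}} (hC : IsClubIn (f j) C) :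
    IsClubIn j (f ⁻¹' C) := by
  have hlimj := isSuccLimit_of_aleph0_lt_cof hj
  refine ⟨fun a ha ↦ ?_, fun x hx hx0 hlim ↦ ?_⟩
  · have hcof : ℵ₀ < (f j).cof := by rwa [cof_map_of_isNormal hf hlimj]
    obtain ⟨_, ⟨hbC, b, -, rfl⟩, hab, hbj⟩ :=
      (hC.inter hcof (isClubIn_univ.image hf hlimj)).1 (f a) (hf.strictMono ha)
    exact ⟨b, hbC, hf.strictMono.le_iff_le.1 hab, hf.strictMono.lt_iff_lt.1 hbj⟩
  · have hxlim : IsSuccLimit x := isSuccLimit_of_forall_lt hx0 fun a ha ↦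
      let ⟨b, _, hb⟩ := hlim a ha
      ⟨b, hb⟩
    refine hC.2 (f x) (hf.strictMono hx)
      (hf.map_isSuccLimit hxlim).ne_bot fun a ha ↦ ?_
    obtain ⟨i, hi, hai⟩ := (hf.lt_iff_exists_lt hxlim).1 ha
    obtain ⟨b, hb, hib, hbx⟩ := hlim i hi
    exact ⟨f b, hb, hai.trans (hf.strictMono hib), hf.strictMono hbx⟩

theorem stationaryIn_map_iff {f : Ordinal.{u} → Ordinal.{u}} (hf : IsNormal f) {j : Ordinal.{u}}
    (hj : ℵ₀ < j.cof) {S : Set Ordinal.{u}} :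
    StationaryIn (f j) S ↔ StationaryIn j (f ⁻¹' S) := by
  simp_rw [stationaryIn_iff]
  constructor
  · intro h E hE
    obtain ⟨_, hxS, ⟨x, hxE, rfl⟩, hxj⟩ := h _ (hE.image hf (isSuccLimit_of_aleph0_lt_cof hj))
    exact ⟨x, hxS, hxE, hf.strictMono.lt_iff_lt.1 hxj⟩
  · intro h C hC
    obtain ⟨x, hxS, hxC, hxj⟩ := h _ (hC.preimage hf hj)
    exact ⟨f x, hxS, hxC, hf.strictMono hxj⟩

theorem exists_isClubIn_mk_le {α : Ordinal.{u}} (hα : IsSuccLimit α) :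
    ∃ C, IsClubIn α C ∧ #C ≤ Cardinal.lift.{u + 1} α.cof := by
  obtain ⟨f, hf, hfα⟩ := exists_isNormal_map_cof hα
  refine ⟨f '' Iio α.cof.ord, ?_, mk_image_le.trans_eq (by rw [Cardinal.mk_Iio_ordinal, card_ord])⟩
  have : IsClubIn α.cof.ord (Iio α.cof.ord) :=
    ⟨fun a ha ↦ ⟨a, ha, le_rfl, ha⟩, fun x hx _ _ ↦ hx⟩
  simpa only [hfα] using this.image hf (isSuccLimit_ord_cof hα)

/-! ### Diagonal intersections and pressing down -/

/-- The diagonal intersection of clubs of a regular cardinal `κ` contains points of every regular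
cofinality `μ < κ` above any given bound. -/
theorem exists_cof_eq_mem_diagonal {κ μ : Cardinal.{u}} (hκ : κ.IsRegular) (hμ : μ.IsRegular)
    (hμκ : μ < κ) {C : Ordinal.{u} → Set Ordinal.{u}} (hC : ∀ γ < κ.ord, IsClubIn κ.ord (C γ))
    {a : Ordinal.{u}} (ha : a < κ.ord) :
    ∃ i < κ.ord, a < i ∧ i.cof = μ ∧ ∀ γ < i, i ∈ C γ := by
  have hκcof : κ.ord.cof = κ := hκ.cof_ord
  have hκ0 : ℵ₀ < κ.ord.cof := by rw [hκcof]; exact hμ.aleph0_le.trans_lt hμκ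
  have hκlim := isSuccLimit_of_aleph0_lt_cof hκ0
  have key : ∀ x, ∃ y, x < κ.ord → (y < κ.ord ∧ x < y ∧ ∀ γ < x, y ∈ C γ) := fun x ↦ by
    by_cases hx : x < κ.ord
    · obtain ⟨y, hy, hxy, hyκ⟩ := (IsClubIn.iInter (ι := Iio x) (C := fun γ ↦ C γ) hκ0 (by
        rw [Cardinal.mk_Iio_ordinal, Cardinal.lift_lift, Cardinal.lift_lt, hκcof]
        exact lt_ord.1 hx) fun γ ↦ hC γ (γ.2.trans hx)).1 (x + 1) (hκlim.succ_lt hx)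
      exact ⟨y, fun _ ↦ ⟨hyκ, (lt_add_one x).trans_le hxy, fun γ hγ ↦ mem_iInter.1 hy ⟨γ, hγ⟩⟩⟩
    · exact ⟨0, fun h ↦ (hx h).elim⟩
  choose G hG using key
  obtain ⟨h, hh, hh1, hh2⟩ := exists_isNormal fun _ ↦ G
  have hlt : ∀ j < κ.ord, h j < κ.ord := by
    have := hh2 κ.ord hκlim fun j _ x hx ↦ (hG x hx).1
    rwa [hκcof] at this
  have hμlim : IsSuccLimit μ.ord := isSuccLimit_ord hμ.aleph0_le
  have hilim : IsSuccLimit (a + μ.ord) := isSuccLimit_add a hμlim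
  have hi : a + μ.ord < κ.ord :=
    isPrincipal_add_ord hκ.aleph0_le ha (ord_lt_ord.2 hμκ)
  -- Between `h j` and `h (j + 1)` there is a point of `C γ` for each `γ < h j`, so that `h` takes
  -- limit ordinals into the diagonal intersection; `a + μ` is a limit of cofinality `μ` beyond `a`.
  refine ⟨h (a + μ.ord), hlt _ hi, ?_, ?_, fun γ hγ ↦ ?_⟩
  · exact (lt_add_of_pos_right a hμlim.bot_lt).trans_le hh.strictMono.le_apply
  · rw [cof_map_of_isNormal hh hilim, cof_add _ hμlim.ne_bot, hμ.cof_ord]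
  · obtain ⟨j, hj, hγj⟩ := (hh.lt_iff_exists_lt hilim).1 hγ
    refine (hC γ (hγ.trans (hlt _ hi))).2 _ (hlt _ hi) (hh.map_isSuccLimit hilim).ne_bot
      fun b hb ↦ ?_
    obtain ⟨j', hj', hbj⟩ := (hh.lt_iff_exists_lt hilim).1 hb
    have hmax : max j j' < a + μ.ord := max_lt hj hj'
    obtain ⟨-, h1, h2⟩ := hG (h (max j j')) (hlt _ (hmax.trans hi))
    exact ⟨G (h (max j j')), h2 γ (hγj.trans_le (hh.monotone (le_max_left _ _))),
      (hbj.trans_le (hh.monotone (le_max_right _ _))).trans h1,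
      (hh1 _).trans (hh.strictMono (hilim.succ_lt hmax))⟩

/-- Pressing down: for each `i > γ` of cofinality `μ` the club `c i` of `f i` has a point in
`[f γ, f γ')` for some `γ' < i`, and one bound `γ'` serves stationarily many `i`. -/
theorem exists_stationaryIn_inter_Ico {κ μ : Cardinal.{u}} (hκ : κ.IsRegular) (hμ : μ.IsRegular)
    (hμκ : μ < κ) {f : Ordinal.{u} → Ordinal.{u}} (hf : IsNormal f)
    {c : Ordinal.{u} → Set Ordinal.{u}} (hc : ∀ i, i.cof = μ → IsClubIn (f i) (c i))
    {γ : Ordinal.{u}} (hγ : γ < κ.ord) :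
    ∃ γ' < κ.ord,
      StationaryIn κ.ord {i | i < κ.ord ∧ i.cof = μ ∧ (c i ∩ Ico (f γ) (f γ')).Nonempty} := by
  by_contra! h
  have key : ∀ γ', ∃ C, γ' < κ.ord → IsClubIn κ.ord C ∧
      ∀ i < κ.ord, i.cof = μ → i ∈ C → ¬ (c i ∩ Ico (f γ) (f γ')).Nonempty := fun γ' ↦ by
    by_cases hγ' : γ' < κ.ord
    · obtain ⟨C, hC, hC'⟩ := not_stationaryIn_iff.1 (h γ' hγ')
      exact ⟨C, fun _ ↦ ⟨hC, fun i hi hiμ hiC hne ↦ (hC' i ⟨hi, hiμ, hne⟩ hiC).not_gt hi⟩⟩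
    · exact ⟨∅, fun h ↦ (hγ' h).elim⟩
  choose C hC using key
  obtain ⟨i, hi, hγi, hiμ, hiC⟩ :=
    exists_cof_eq_mem_diagonal hκ hμ hμκ (fun γ' hγ' ↦ (hC γ' hγ').1) hγ
  have hilim : IsSuccLimit i := Ordinal.one_lt_cof_iff.1 (hiμ ▸ one_lt_aleph0.trans_le hμ.aleph0_le)
  obtain ⟨x, hx, hγx, hxi⟩ := (hc i hiμ).1 (f γ) (hf.strictMono hγi)
  obtain ⟨γ', hγ', hxγ'⟩ := (hf.lt_iff_exists_lt hilim).1 hxi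
  exact (hC γ' (hγ'.trans hi)).2 i hi hiμ (hiC γ' hγ') ⟨x, hx, hγx, hxγ'⟩

/-- A set meeting `ρ` successive intervals has order type at least `ρ`. -/
theorem lift_le_typeLT_of_inter_Ico_nonempty {X : Set Ordinal.{u}} {h : Ordinal.{u} → Ordinal.{u}}
    (hh : Monotone h) {ρ : Ordinal.{u}} (hX : ∀ i < ρ, (X ∩ Ico (h i) (h (i + 1))).Nonempty) :
    Ordinal.lift.{u + 1} ρ ≤ typeLT X := by
  choose x hx using hX
  rw [← type_lt_Iio]
  refine type_le_iff'.2 ⟨(OrderEmbedding.ofStrictMono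
    (fun i : Iio ρ ↦ (⟨x i i.2, (hx i i.2).1⟩ : X)) fun i j hij ↦ ?_).ltEmbedding⟩
  exact (hx i i.2).2.2.trans_le ((hh (add_one_le_of_lt hij)).trans (hx j j.2).2.1)

/-! ### Points of fixed cofinality -/

theorem isRegular_aleph_natCast (n : ℕ) : (ℵ_ (n : Ordinal.{u})).IsRegular := by
  cases n with
  | zero => simpa using isRegular_aleph0
  | succ n => simpa using isRegular_aleph_add_one (n : Ordinal.{u})

theorem cof_omega_natCast (n : ℕ) : (ω_ (n : Ordinal.{u})).cof = ℵ_ (n : Ordinal.{u}) :=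
  (isRegular_aleph_natCast n).cof_omega_eq

theorem stationaryIn_cofSet {l n : ℕ} (hln : l < n) :
    StationaryIn (ω_ (n : Ordinal.{u})) (cofSet n l) := by
  refine stationaryIn_iff.2 fun C hC ↦ ?_
  rw [← ord_aleph] at hC ⊢
  obtain ⟨i, hi, hi0, hil, hiC⟩ := exists_cof_eq_mem_diagonal (isRegular_aleph_natCast n)
    (isRegular_aleph_natCast l) (aleph_lt_aleph.2 (by exact_mod_cast hln)) (fun _ _ ↦ hC)
    (isSuccLimit_ord (isRegular_aleph_natCast n).aleph0_le).bot_lt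
  exact ⟨i, ⟨by rwa [ord_aleph] at hi, hil⟩, hiC ⊥ hi0, hi⟩

theorem stationaryIn_iUnion_iff {γ : Ordinal.{u}} (hγ : ℵ₀ < γ.cof) {ι : Type v}
    (hι : Cardinal.lift.{u + 1} #ι < Cardinal.lift.{max v (u + 1)} γ.cof)
    {S : ι → Set Ordinal.{u}} : StationaryIn γ (⋃ i, S i) ↔ ∃ i, StationaryIn γ (S i) := by
  unfold StationaryIn
  rw [preimage_iUnion]
  refine isStationary_iUnion_iff ?_ ?_
  · rw [cof_Iio_eq_lift]
    exact (aleph0_lt_lift.2 hγ).ne'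
  · rw [cof_Iio_eq_lift, Cardinal.lift_lift]
    exact hι

/-! ### A set that does not reflect -/

/-- The union of the sets `c β` over those `β ∈ c α` that have cofinality `μ`. -/
def ladderPoints (c : Ordinal.{u} → Set Ordinal.{u}) (μ : Cardinal.{u}) (α : Ordinal.{u}) :
    Set Ordinal.{u} :=
  ⋃ β : {β // β ∈ c α ∧ β.cof = μ}, c β

theorem mk_ladderPoints_le {c : Ordinal.{u} → Set Ordinal.{u}}
    (hc : ∀ α, IsSuccLimit α → #(c α) ≤ Cardinal.lift.{u + 1} α.cof) {μ ν : Cardinal.{u}}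
    (hμ : ℵ₀ ≤ μ) (hμν : μ ≤ ν) {α : Ordinal.{u}} (hα : α.cof = ν) :
    #(ladderPoints c μ α) ≤ Cardinal.lift.{u + 1} ν := by
  have hlim : ∀ {β : Ordinal.{u}}, ℵ₀ ≤ β.cof → IsSuccLimit β := fun h ↦
    Ordinal.one_lt_cof_iff.1 (one_lt_aleph0.trans_le h)
  have hν : ℵ₀ ≤ Cardinal.lift.{u + 1} ν := aleph0_le_lift.2 (hμ.trans hμν)
  refine (mk_iUnion_le _).trans ((mul_le_mul' ?_ (ciSup_le' fun β ↦ ?_)).trans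
    (mul_eq_self hν).le)
  · exact (mk_subtype_mono fun β hβ ↦ hβ.1).trans (hα ▸ hc α (hlim (hα ▸ hμ.trans hμν)))
  · obtain ⟨β, -, rfl⟩ := β
    exact (hc β (hlim hμ)).trans (Cardinal.lift_le.2 hμν)

/-- If for some `k < m - 1` all stationary subsets of `S^m_k` reflect fully in `S^m_{m-1}`, then
for `n > m` some stationary subset of `S^n_{m-1}` reflects at no point of `S^n_m`. -/
theorem exists_stationaryIn_not_reflectsAt {k m n : ℕ} (hk : k < m - 1) (hmn : m < n)
    (hrefl : ∀ S : Set Ordinal.{u}, S ⊆ cofSet m k → StationaryIn (ω_ (m : Ordinal.{u})) S →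
      ReflectsFully (ω_ (m : Ordinal.{u})) S (cofSet m (m - 1))) :
    ∃ A : Set Ordinal.{u}, A ⊆ cofSet n (m - 1) ∧ StationaryIn (ω_ (n : Ordinal.{u})) A ∧
      ∀ δ ∈ cofSet.{u} n m, ¬ ReflectsAt A δ := by
  have haleph : ∀ {a b : ℕ}, a < b → ℵ_ (a : Ordinal.{u}) < ℵ_ (b : Ordinal.{u}) :=
    fun h ↦ aleph_lt_aleph.2 (by exact_mod_cast h)
  have haleph0 : ∀ {b : ℕ}, 0 < b → ℵ₀ < ℵ_ (b : Ordinal.{u}) := fun h ↦ by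
    simpa using haleph h
  have hladder : ∀ α : Ordinal.{u}, ∃ C, IsSuccLimit α →
      IsClubIn α C ∧ #C ≤ Cardinal.lift.{u + 1} α.cof := fun α ↦ by
    by_cases hα : IsSuccLimit α
    · obtain ⟨C, hC⟩ := exists_isClubIn_mk_le hα
      exact ⟨C, fun _ ↦ hC⟩
    · exact ⟨∅, fun h ↦ (hα h).elim⟩
  choose c hc using hladder
  let X := ladderPoints c (ℵ_ (k : Ordinal.{u}))
  let A : Ordinal.{u} → Set Ordinal.{u} := fun ρ ↦
    {α ∈ cofSet n (m - 1) | typeLT (X α) = Ordinal.lift.{u + 1} ρ}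
  -- The sets `A ρ`, for the fewer than `ℵ_n` ordinals `ρ < ω_m`, cover the stationary `S^n_{m-1}`.
  obtain ⟨⟨ρ, hρ⟩, hA⟩ : ∃ ρ : Iio (ω_ (m : Ordinal.{u})),
      StationaryIn (ω_ (n : Ordinal.{u})) (A ρ) := by
    have hcard : Cardinal.lift.{u + 1} #(Iio (ω_ (m : Ordinal.{u}))) <
        Cardinal.lift.{u + 1} (ω_ (n : Ordinal.{u})).cof := by
      rw [Cardinal.mk_Iio_ordinal, Cardinal.lift_lift, Cardinal.lift_lt, card_omega,
        cof_omega_natCast]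
      exact haleph hmn
    refine (stationaryIn_iUnion_iff (by rw [cof_omega_natCast]; exact haleph0 (by omega))
      hcard).1 ?_
    refine IsStationary.mono (stationaryIn_cofSet (by omega : m - 1 < n))
      (preimage_mono fun α hα ↦ ?_)
    have hlt : typeLT (X α) < Ordinal.lift.{u + 1} (ω_ (m : Ordinal.{u})) := by
      rw [← ord_aleph, lift_ord, lt_ord, card_type]
      refine (mk_ladderPoints_le (fun β hβ ↦ (hc β hβ).2) (aleph0_le_aleph _) (haleph hk).le
        hα.2).trans_lt (Cardinal.lift_lt.2 (haleph (by omega)))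
    obtain ⟨ρ, hρ⟩ := Ordinal.mem_range_lift_of_le hlt.le
    refine mem_iUnion.2 ⟨⟨ρ, ?_⟩, hα, hρ.symm⟩
    rwa [← hρ, Ordinal.lift_lt] at hlt
  refine ⟨A ρ, fun α hα ↦ hα.1, hA, fun δ hδ hAδ ↦ ?_⟩
  have hm0 : ℵ₀ < (ω_ (m : Ordinal.{u})).cof := by
    rw [cof_omega_natCast]; exact haleph0 (by omega)
  have hmlim := isSuccLimit_of_aleph0_lt_cof hm0
  obtain ⟨f, hf, hfδ⟩ := exists_isNormal_map_cof (isSuccLimit_of_aleph0_lt_cof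
    (hδ.2 ▸ haleph0 (by omega : 0 < m)))
  rw [hδ.2, ord_aleph] at hfδ
  have hlim_k : ∀ i : Ordinal.{u}, i.cof = ℵ_ (k : Ordinal.{u}) → IsSuccLimit i := fun i hi ↦
    Ordinal.one_lt_cof_iff.1 (hi ▸ one_lt_aleph0.trans_le (aleph0_le_aleph _))
  let P : Ordinal.{u} → Ordinal.{u} → Set Ordinal.{u} := fun γ γ' ↦
    {i | i < ω_ (m : Ordinal.{u}) ∧ i.cof = ℵ_ (k : Ordinal.{u}) ∧
      (c (f i) ∩ Ico (f γ) (f γ')).Nonempty}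
  -- `H γ` will be a bound such that `c (f i)` meets `[f γ, f (H γ))` stationarily often.
  have hpress : ∀ γ, ∃ γ', γ < ω_ (m : Ordinal.{u}) →
      γ' < ω_ (m : Ordinal.{u}) ∧ StationaryIn (ω_ (m : Ordinal.{u})) (P γ γ') := fun γ ↦ by
    by_cases hγ : γ < ω_ (m : Ordinal.{u})
    · rw [← ord_aleph] at hγ
      obtain ⟨γ', h⟩ := exists_stationaryIn_inter_Ico (isRegular_aleph_natCast m)
        (isRegular_aleph_natCast k) (haleph (by omega)) hf (c := fun i ↦ c (f i))
        (fun i hi ↦ (hc _ (hf.map_isSuccLimit (hlim_k i hi))).1) hγ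
      rw [ord_aleph] at h
      exact ⟨γ', fun _ ↦ h⟩
    · exact ⟨0, fun h ↦ (hγ h).elim⟩
  choose H hH using hpress
  -- The `P (h i) (H (h i))` record visits to the intervals `[f (h i), f (h (i + 1)))`, which are
  -- pairwise disjoint because `H (h i) < h (i + 1)`.
  obtain ⟨h, hh, hh1, hh2⟩ := exists_isNormal fun _ ↦ H
  have hhlt : ∀ i < ω_ (m : Ordinal.{u}), h i < ω_ (m : Ordinal.{u}) := by
    have := hh2 _ hmlim fun j _ x hx ↦ (hH x hx).1
    rwa [cof_omega_natCast, ord_aleph] at this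
  have hclub : ∀ i : Iio (ρ + 1), ∃ E, IsClubIn (ω_ (m : Ordinal.{u})) E ∧
      ∀ j ∈ E, j ∈ cofSet m (m - 1) → StationaryIn j (P (h i) (H (h i))) := fun i ↦ by
    have hi : h i < ω_ (m : Ordinal.{u}) := hhlt i (i.2.trans (hmlim.succ_lt hρ))
    obtain ⟨E, hE, hE'⟩ := not_stationaryIn_iff.1
      (hrefl (P (h i) (H (h i))) (fun i hi ↦ ⟨hi.1, hi.2.1⟩) (hH _ hi).2)
    refine ⟨E, hE, fun j hjE hj ↦ ?_⟩
    by_contra hns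
    exact (hE' j ⟨hj, hns⟩ hjE).not_gt hj.1
  choose E hE hE' using hclub
  -- Restricting to limit `j` ensures that `f j` has the same cofinality as `j`.
  obtain ⟨j, hjA, ⟨hjE, hjlim⟩, hjm⟩ := stationaryIn_iff.1
    ((stationaryIn_map_iff hf hm0).1 (hfδ.symm ▸ hAδ : StationaryIn _ (A ρ))) _
    ((IsClubIn.iInter hm0 (by
      rw [Cardinal.mk_Iio_ordinal, Cardinal.lift_lift, Cardinal.lift_lt, cof_omega_natCast,
        ← lt_ord, ord_aleph]
      exact hmlim.succ_lt hρ) hE).inter hm0 (isClubIn_isSuccLimit hm0))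
  have hjcof : j.cof = ℵ_ ((m - 1 : ℕ) : Ordinal.{u}) := by
    rw [← cof_map_of_isNormal hf hjlim, hjA.1.2]
  have hj0 : ℵ₀ < j.cof := hjcof ▸ haleph0 (by omega)
  have hle : Ordinal.lift.{u + 1} (ρ + 1) ≤ typeLT (X (f j)) := by
    refine lift_le_typeLT_of_inter_Ico_nonempty (h := f ∘ h) (hf.comp hh).monotone fun i hi ↦ ?_
    obtain ⟨i', ⟨-, hi'k, x, hx, hx1, hx2⟩, hi'c, -⟩ := stationaryIn_iff.1
      (hE' ⟨i, hi⟩ j (mem_iInter.1 hjE _) ⟨hjm, hjcof⟩) _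
      ((hc _ (hf.map_isSuccLimit hjlim)).1.preimage hf hj0)
    refine ⟨x, mem_iUnion.2 ⟨⟨f i', hi'c, ?_⟩, hx⟩, hx1, hx2.trans (hf.strictMono (hh1 i))⟩
    rw [cof_map_of_isNormal hf (hlim_k i' hi'k), hi'k]
  rw [hjA.2, Ordinal.lift_le] at hle
  exact hle.not_gt (lt_add_one ρ)

end FullReflection

theorem mainTheorem2 (m : ℕ) (hm : 2 ≤ m) :
    (∀ k : ℕ, k < m - 1 →
      ∃ S : Set Ordinal.{u}, S ⊆ FullReflection.cofSet m k ∧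
        FullReflection.StationaryIn (Ordinal.omega (m : Ordinal.{u})) S ∧
        ¬ FullReflection.ReflectsFully (Ordinal.omega (m : Ordinal.{u})) S
            (FullReflection.cofSet m (m - 1))) ∨
    (∀ n : ℕ, m < n →
      ∃ A : Set Ordinal.{u}, A ⊆ FullReflection.cofSet n (m - 1) ∧
        FullReflection.StationaryIn (Ordinal.omega (n : Ordinal.{u})) A ∧
        ∀ δ ∈ FullReflection.cofSet.{u} n m, ¬ FullReflection.ReflectsAt A δ) := by
  refine or_iff_not_imp_left.2 fun hnot n hmn ↦ ?_
  push Not at hnot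
  obtain ⟨k, hk, hrefl⟩ := hnot
  exact FullReflection.exists_stationaryIn_not_reflectsAt hk hmn hrefl
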